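/- All rings are unital, and modules are left modules unless stated otherwise. A ring $R$ that is left and right noetherian and has finite left and right injective dimension as a module over itself is \emph{Auslander-Gorenstein} if, for every finitely generated left or right $R$-module $L$, every $j\ge 0$ and every submodule $P\subseteq \operatorname{Ext}^j_R(L,R)$, one has $\operatorname{Ext}^i_R(P,R)=0$ for all $i<j$; it is \emph{Auslander-regular} if in addition it has finite global dimension. The grade of an $R$-module $L$ is $j_R(L)=\min\{j : \operatorname{Ext}^j_R(L,R)\neq 0\}$. For $p\in\mathbb{N}$, the module $L$ is \emph{$p$-CM} if $\operatorname{Ext}^i_R(L,R)=0$ for all $i\neq p$, and \emph{CM} if it is $p$-CM for some $p\in\mathbb N$. An algebra $R$ over a field $k$ with finite Gelfand-Kirillov dimension is \emph{CM} if $j_R(L)+\operatorname{GKdim}(L)=\operatorname{GKdim}(R)$ for all nonzero finitely generated left or right $R$-modules $L$. Let $k$ be a field, let $S$ be a $k$-algebra that is Auslander-regular and CM, and let $A$ be a $k$-algebra that is Auslander-Gorenstein and CM. Let $n,m\in\mathbb{N}$. Let $N$ be a finitely generated left $A$-module that is CM and has projective dimension $n$ (so that $N$ is $n$-CM), and let $M$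 be an $(S,A)$-bimodule that is finitely generated and $m$-CM as a left $S$-module. Assume that $$\operatorname{Ext}^i_S(\operatorname{Tor}_j^A(M,N),S)=0\qquad\text{for all } j\ge 0 \text{ and all } i\neq n+m .$$ Then: (1) there is an isomorphism of right $S$-modules $$\operatorname{Ext}^{n+m}_S(M\otimes_A N,S)\;\cong\;\operatorname{Ext}^n_A(N,A)\otimes_A\operatorname{Ext}^m_S(M,S);$$ (2) $\operatorname{Tor}_i^A(M,N)=0$ for all $i>0$. -/

import Mathlib

open CategoryTheory
open MulOpposite (op)
open scoped TensorProduct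

universe u v

/-! Throughout, a left `R`-module is a `Module R L`, a right `R`-module is a `Module Rᵐᵒᵖ L`, and an
`(S, A)`-bimodule carries `Module S M`, `Module Aᵐᵒᵖ M` and `SMulCommClass S Aᵐᵒᵖ M`. -/

/-! ### The tensor product over a noncommutative ring -/

/-- The subgroup of `M ⊗[ℤ] N` generated by all `(x • a) ⊗ y - x ⊗ (a • y)`. -/
def balancedRel (A : Type*) [Ring A] (M : Type*) [AddCommGroup M] [Module Aᵐᵒᵖ M]
    (N : Type*) [AddCommGroup N] [Module A N] : AddSubgroup (M ⊗[ℤ] N) :=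
  AddSubgroup.closure
    {z | ∃ (x : M) (a : A) (y : N), z = (op a • x) ⊗ₜ[ℤ] y - x ⊗ₜ[ℤ] (a • y)}

/-- The tensor product `M ⊗_A N` of a right `A`-module `M` and a left `A`-module `N`. -/
def BalancedTensor (A : Type*) [Ring A] (M : Type*) [AddCommGroup M] [Module Aᵐᵒᵖ M]
    (N : Type*) [AddCommGroup N] [Module A N] :=
  (M ⊗[ℤ] N) ⧸ balancedRel A M N

namespace BalancedTensor

section

variable (A : Type*) [Ring A] (M : Type*) [AddCommGroup M] [Module Aᵐᵒᵖ M]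
  (N : Type*) [AddCommGroup N] [Module A N]

noncomputable instance : AddCommGroup (BalancedTensor A M N) :=
  inferInstanceAs (AddCommGroup ((M ⊗[ℤ] N) ⧸ balancedRel A M N))

variable {M N}

/-- The class `x ⊗ y` of a pure tensor. -/
noncomputable def tmul (x : M) (y : N) : BalancedTensor A M N :=
  QuotientAddGroup.mk (x ⊗ₜ[ℤ] y)

variable {A}

theorem tmul_add (x : M) (y y' : N) : tmul A x (y + y') = tmul A x y + tmul A x y' := by
  unfold tmul; rw [TensorProduct.tmul_add]; rfl

theorem add_tmul (x x' : M) (y : N) : tmul A (x + x') y = tmul A x y + tmul A x' y := by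
  unfold tmul; rw [TensorProduct.add_tmul]; rfl

theorem op_smul_tmul (x : M) (a : A) (y : N) : tmul A (op a • x) y = tmul A x (a • y) :=
  (QuotientAddGroup.eq_iff_sub_mem).2 (AddSubgroup.subset_closure ⟨x, a, y, rfl⟩)

theorem induction {p : BalancedTensor A M N → Prop} (h0 : p 0) (ht : ∀ x y, p (tmul A x y))
    (ha : ∀ z w, p z → p w → p (z + w)) (z : BalancedTensor A M N) : p z := by
  obtain ⟨z, rfl⟩ := QuotientAddGroup.mk_surjective z
  induction z using TensorProduct.induction_on with
  | zero => exact h0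
  | tmul x y => exact ht x y
  | add z w hz hw => exact ha _ _ hz hw

theorem hom_ext {G : Type*} [AddCommGroup G] {f g : BalancedTensor A M N →+ G}
    (h : ∀ x y, f (tmul A x y) = g (tmul A x y)) : f = g := by
  ext z
  induction z using BalancedTensor.induction with
  | h0 => simp
  | ht x y => exact h x y
  | ha z w hz hw => simp [hz, hw]

variable {M' : Type*} [AddCommGroup M'] [Module Aᵐᵒᵖ M'] {N' : Type*} [AddCommGroup N'] [Module A N']
  {M'' : Type*} [AddCommGroup M''] [Module Aᵐᵒᵖ M'']
  {N'' : Type*} [AddCommGroup N''] [Module A N'']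

/-- The additive map `f ⊗ g`. -/
noncomputable def map (f : M →ₗ[Aᵐᵒᵖ] M') (g : N →ₗ[A] N') :
    BalancedTensor A M N →+ BalancedTensor A M' N' :=
  QuotientAddGroup.map (balancedRel A M N) (balancedRel A M' N')
    (TensorProduct.map f.toAddMonoidHom.toIntLinearMap
      g.toAddMonoidHom.toIntLinearMap).toAddMonoidHom (by
      refine (AddSubgroup.closure_le _).2 ?_
      rintro _ ⟨x, a, y, rfl⟩
      refine AddSubgroup.subset_closure ⟨f x, a, g y, ?_⟩
      rw [map_sub]
      exact congrArg₂ (fun p q => p ⊗ₜ[ℤ] g y - f x ⊗ₜ[ℤ] q) (f.map_smul (op a) x)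
        (g.map_smul a y))

@[simp]
theorem map_tmul (f : M →ₗ[Aᵐᵒᵖ] M') (g : N →ₗ[A] N') (x : M) (y : N) :
    map f g (tmul A x y) = tmul A (f x) (g y) := rfl

theorem map_id : map (A := A) (LinearMap.id : M →ₗ[Aᵐᵒᵖ] M) (LinearMap.id : N →ₗ[A] N) =
    AddMonoidHom.id _ := hom_ext fun _ _ => rfl

theorem map_comp_apply (f : M →ₗ[Aᵐᵒᵖ] M') (g : N →ₗ[A] N') (f' : M' →ₗ[Aᵐᵒᵖ] M'')
    (g' : N' →ₗ[A] N'') (z : BalancedTensor A M N) :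
    map f' g' (map f g z) = map (f' ∘ₗ f) (g' ∘ₗ g) z :=
  DFunLike.congr_fun (f := (map f' g').comp (map f g)) (g := map (f' ∘ₗ f) (g' ∘ₗ g))
    (hom_ext fun _ _ => rfl) z

theorem map_add_left (f f' : M →ₗ[Aᵐᵒᵖ] M') (g : N →ₗ[A] N') :
    map (f + f') g = map f g + map f' g :=
  hom_ext fun _ _ => add_tmul _ _ _

theorem map_add_right (f : M →ₗ[Aᵐᵒᵖ] M') (g g' : N →ₗ[A] N') :
    map f (g + g') = map f g + map f g' :=
  hom_ext fun _ _ => tmul_add _ _ _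

theorem map_zero_left (g : N →ₗ[A] N') : map (0 : M →ₗ[Aᵐᵒᵖ] M') g = 0 := by
  have h := map_add_left (0 : M →ₗ[Aᵐᵒᵖ] M') 0 g
  simpa using h

theorem map_zero_right (f : M →ₗ[Aᵐᵒᵖ] M') : map f (0 : N →ₗ[A] N') = 0 := by
  have h := map_add_right f (0 : N →ₗ[A] N') 0
  simpa using h

end

section Modules

variable (T A : Type*) [Ring T] [Ring A] (M : Type*) [AddCommGroup M] [Module Aᵐᵒᵖ M]
  (N : Type*) [AddCommGroup N] [Module A N]

/-- The action on `M ⊗_A N` induced by an action on `M`: `t • (x ⊗ y) = (t • x) ⊗ y`. -/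
noncomputable abbrev leftModule [Module T M] [SMulCommClass T Aᵐᵒᵖ M] :
    Module T (BalancedTensor A M N) where
  smul t z := map (DistribSMul.toLinearMap Aᵐᵒᵖ M t) LinearMap.id z
  one_smul z := by
    change map (DistribSMul.toLinearMap Aᵐᵒᵖ M (1 : T)) LinearMap.id z = z
    rw [show DistribSMul.toLinearMap Aᵐᵒᵖ M (1 : T) = LinearMap.id by ext; simp, map_id]; rfl
  mul_smul s t z := by
    change map _ _ z = map _ _ (map _ _ z)
    rw [map_comp_apply]; congr 2; ext; simp [mul_smul]
  smul_zero t := _root_.map_zero _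
  smul_add t z w := _root_.map_add _ z w
  add_smul s t z := by
    change map _ _ z = map _ _ z + map _ _ z
    rw [← AddMonoidHom.add_apply, ← map_add_left]; congr 2; ext; simp [add_smul]
  zero_smul z := by
    change map (DistribSMul.toLinearMap Aᵐᵒᵖ M (0 : T)) LinearMap.id z = 0
    rw [show DistribSMul.toLinearMap Aᵐᵒᵖ M (0 : T) = 0 by ext; simp, map_zero_left]; rfl

/-- The action on `M ⊗_A N` induced by an action on `N`: `t • (x ⊗ y) = x ⊗ (t • y)`. -/
noncomputable abbrev rightModule [Module T N] [SMulCommClass T A N] :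
    Module T (BalancedTensor A M N) where
  smul t z := map LinearMap.id (DistribSMul.toLinearMap A N t) z
  one_smul z := by
    change map LinearMap.id (DistribSMul.toLinearMap A N (1 : T)) z = z
    rw [show DistribSMul.toLinearMap A N (1 : T) = LinearMap.id by ext; simp, map_id]; rfl
  mul_smul s t z := by
    change map _ _ z = map _ _ (map _ _ z)
    rw [map_comp_apply]; congr 2; ext; simp [mul_smul]
  smul_zero t := _root_.map_zero _
  smul_add t z w := _root_.map_add _ z w
  add_smul s t z := by
    change map _ _ z = map _ _ z + map _ _ z
    rw [← AddMonoidHom.add_apply, ← map_add_right]; congr 2; ext; simp [add_smul]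
  zero_smul z := by
    change map LinearMap.id (DistribSMul.toLinearMap A N (0 : T)) z = 0
    rw [show DistribSMul.toLinearMap A N (0 : T) = 0 by ext; simp, map_zero_right]; rfl

end Modules

end BalancedTensor

/-! ### Tor as a left module -/

section Tor

variable (S A : Type u) [Ring S] [Ring A] (M : Type u) [AddCommGroup M] [Module S M]
  [Module Aᵐᵒᵖ M] [SMulCommClass S Aᵐᵒᵖ M]

/-- `M ⊗_A N` as a left `S`-module. -/
noncomputable def bimoduleTensorObj (N : ModuleCat.{u} A) : ModuleCat.{u} S :=
  letI := BalancedTensor.leftModule S A M N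
  ModuleCat.of S (BalancedTensor A M N)

variable {A} in
/-- The `S`-linear map `id ⊗ g`. -/
noncomputable def bimoduleTensorMap {N N' : ModuleCat.{u} A} (g : N ⟶ N') :
    bimoduleTensorObj S A M N ⟶ bimoduleTensorObj S A M N' :=
  letI := BalancedTensor.leftModule S A M N
  letI := BalancedTensor.leftModule S A M N'
  ModuleCat.ofHom
    { toFun := BalancedTensor.map LinearMap.id g.hom
      map_add' := _root_.map_add _
      map_smul' := fun s z => by
        change BalancedTensor.map _ _ (BalancedTensor.map _ _ z) =
          BalancedTensor.map _ _ (BalancedTensor.map _ _ z)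
        rw [BalancedTensor.map_comp_apply, BalancedTensor.map_comp_apply]; rfl }

/-- The functor `M ⊗_A -` from left `A`-modules to left `S`-modules, for an `(S, A)`-bimodule. -/
noncomputable def bimoduleTensor : ModuleCat.{u} A ⥤ ModuleCat.{u} S where
  obj N := bimoduleTensorObj S A M N
  map g := bimoduleTensorMap S M g
  map_id N := ModuleCat.hom_ext <| LinearMap.ext fun z =>
    DFunLike.congr_fun (BalancedTensor.map_id (A := A) (M := M) (N := N)) z
  map_comp g g' := ModuleCat.hom_ext <| LinearMap.ext fun z =>
    (BalancedTensor.map_comp_apply LinearMap.id g.hom LinearMap.id g'.hom z).symm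

instance : (bimoduleTensor S A M).Additive where
  map_add {_ _ g g'} := ModuleCat.hom_ext <| LinearMap.ext fun z =>
    DFunLike.congr_fun
      (BalancedTensor.map_add_right (LinearMap.id : M →ₗ[Aᵐᵒᵖ] M) g.hom g'.hom) z

/-- `Tor_j^A(M, N)` as a left `S`-module, for an `(S, A)`-bimodule `M` and a left `A`-module `N`. -/
noncomputable def bimoduleTor (j : ℕ) (N : Type u) [AddCommGroup N] [Module A N] : ModuleCat.{u} S :=
  ((bimoduleTensor S A M).leftDerived j).obj (ModuleCat.of A N)

end Tor

/-! ### The modules `Ext^j_R(L, R)` -/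

/-- `Ext^j_R(L, R)` for a left `R`-module `L`. -/
def ExtDual (R : Type u) [Ring R] (L : Type u) [AddCommGroup L] [Module R L] (j : ℕ) : Type u :=
  Abelian.Ext.{u} (ModuleCat.of R L) (ModuleCat.of R R) j

namespace ExtDual

open Abelian

variable (R : Type u) [Ring R] (L : Type u) [AddCommGroup L] [Module R L] (j : ℕ)

noncomputable instance : AddCommGroup (ExtDual R L j) :=
  inferInstanceAs (AddCommGroup (Ext.{u} (ModuleCat.of R L) (ModuleCat.of R R) j))

/-- The action of an operator commuting with `R`, as a morphism of left `R`-modules. -/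
def smulHom {T : Type*} [Ring T] (X : Type u) [AddCommGroup X] [Module R X] [Module T X]
    [SMulCommClass T R X] (t : T) : ModuleCat.of R X ⟶ ModuleCat.of R X :=
  ModuleCat.ofHom (DistribSMul.toLinearMap R X t)

section

variable {T : Type*} [Ring T] (X : Type u) [AddCommGroup X] [Module R X] [Module T X]
    [SMulCommClass T R X]

theorem smulHom_one : smulHom R X (1 : T) = 𝟙 _ := by ext; simp [smulHom]

theorem smulHom_mul (s t : T) : smulHom R X (s * t) = smulHom R X t ≫ smulHom R X s := by
  ext; simp [smulHom, mul_smul]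

theorem smulHom_zero : smulHom R X (0 : T) = 0 := by ext; simp [smulHom]

theorem smulHom_add (s t : T) : smulHom R X (s + t) = smulHom R X s + smulHom R X t := by
  ext; simp [smulHom, add_smul]

end

/-- The right `R`-module structure on `Ext^j_R(L, R)`: an element `r` acts by functoriality in the
second variable, through the left `R`-linear map `R → R`, `x ↦ x * r`. -/
noncomputable abbrev extRightModule :
    Module Rᵐᵒᵖ (Ext.{u} (ModuleCat.of R L) (ModuleCat.of R R) j) where
  smul r x := x.comp (Ext.mk₀ (smulHom R R r)) (add_zero j)
  one_smul x := by
    change x.comp (Ext.mk₀ (smulHom R R 1)) (add_zero j) = x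
    rw [smulHom_one, Ext.comp_mk₀_id]
  mul_smul r s x := by
    change x.comp (Ext.mk₀ (smulHom R R (r * s))) (add_zero j) =
      (x.comp (Ext.mk₀ (smulHom R R s)) (add_zero j)).comp
        (Ext.mk₀ (smulHom R R r)) (add_zero j)
    rw [smulHom_mul, ← Ext.mk₀_comp_mk₀, Ext.comp_assoc_of_third_deg_zero]
  smul_zero r := Ext.zero_comp _ _ _ _ _
  smul_add r x y := Ext.add_comp _ _ _ _
  add_smul r s x := by
    change x.comp (Ext.mk₀ (smulHom R R (r + s))) (add_zero j) = _
    rw [smulHom_add, Ext.mk₀_add, Ext.comp_add]; rfl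
  zero_smul x := by
    change x.comp (Ext.mk₀ (smulHom R R 0)) (add_zero j) = _
    rw [smulHom_zero, Ext.mk₀_zero, Ext.comp_zero]

noncomputable instance : Module Rᵐᵒᵖ (ExtDual R L j) := extRightModule R L j

variable (B : Type*) [Ring B] [Module Bᵐᵒᵖ L]

/-- The left `B`-module structure on `Ext^j_R(L, R)` for an `(R, B)`-bimodule `L`: an element `b` acts
by functoriality in the first variable, through the left `R`-linear map `L → L`, `x ↦ x * b`. -/
noncomputable abbrev extLeftModule [SMulCommClass Bᵐᵒᵖ R L] :
    Module B (Ext.{u} (ModuleCat.of R L) (ModuleCat.of R R) j) where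
  smul b x := (Ext.mk₀ (smulHom R L (op b))).comp x (zero_add j)
  one_smul x := by
    change (Ext.mk₀ (smulHom R L (op (1 : B)))).comp x (zero_add j) = x
    rw [MulOpposite.op_one, smulHom_one, Ext.mk₀_id_comp]
  mul_smul b c x := by
    change (Ext.mk₀ (smulHom R L (op (b * c)))).comp x (zero_add j) =
      (Ext.mk₀ (smulHom R L (op b))).comp
        ((Ext.mk₀ (smulHom R L (op c))).comp x (zero_add j)) (zero_add j)
    rw [MulOpposite.op_mul, smulHom_mul, Ext.mk₀_comp_mk₀_assoc]
  smul_zero b := Ext.comp_zero _ _ _ _ _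
  smul_add b x y := Ext.comp_add _ _ _ _
  add_smul b c x := by
    change (Ext.mk₀ (smulHom R L (op (b + c)))).comp x (zero_add j) = _
    rw [MulOpposite.op_add, smulHom_add, Ext.mk₀_add, Ext.add_comp]; rfl
  zero_smul x := by
    change (Ext.mk₀ (smulHom R L (op (0 : B)))).comp x (zero_add j) = _
    rw [MulOpposite.op_zero, smulHom_zero, Ext.mk₀_zero, Ext.zero_comp]

variable [SMulCommClass R Bᵐᵒᵖ L]

noncomputable instance : Module B (ExtDual R L j) :=
  haveI : SMulCommClass Bᵐᵒᵖ R L := SMulCommClass.symm _ _ _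
  extLeftModule R L j B

instance : SMulCommClass Rᵐᵒᵖ B (ExtDual R L j) where
  smul_comm r b x := by
    have : SMulCommClass Bᵐᵒᵖ R L := SMulCommClass.symm _ _ _
    exact Ext.comp_assoc_of_third_deg_zero (Ext.mk₀ (smulHom R L (op b)))
      (x : Ext.{u} (ModuleCat.of R L) (ModuleCat.of R R) j) (Ext.mk₀ (smulHom R R r)) (zero_add j)

end ExtDual

/-! ### Auslander-Gorenstein rings, grade and Cohen-Macaulay modules -/

section Rings

variable (R : Type u) [Ring R]

/-- For every finitely generated left `R`-module `L` and every (right) submodule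
`P ⊆ Ext^j_R(L, R)`, one has `Ext^i_R(P, R) = 0` for all `i < j`. -/
def LeftAuslanderCondition : Prop :=
  ∀ (L : Type u) [AddCommGroup L] [Module R L], Module.Finite R L →
    ∀ (j : ℕ) (P : Submodule Rᵐᵒᵖ (ExtDual R L j)), ∀ i < j, Subsingleton (ExtDual Rᵐᵒᵖ P i)

/-- Auslander-Gorenstein rings. Right `R`-modules are left `Rᵐᵒᵖ`-modules, so each right-hand
condition is the left-hand one for `Rᵐᵒᵖ`. -/
structure IsAuslanderGorenstein : Prop where
  noetherian_left : IsNoetherianRing R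
  noetherian_right : IsNoetherianRing Rᵐᵒᵖ
  injdim_left : injectiveDimension (ModuleCat.of R R) < ⊤
  injdim_right : injectiveDimension (ModuleCat.of Rᵐᵒᵖ Rᵐᵒᵖ) < ⊤
  auslander_left : LeftAuslanderCondition R
  auslander_right : LeftAuslanderCondition Rᵐᵒᵖ

/-- The left global dimension of `R` is finite. -/
def FiniteLeftGlobalDimension : Prop :=
  ∃ d : ℕ, ∀ X : ModuleCat.{u} R, projectiveDimension X ≤ d

/-- Auslander-regular rings. -/
structure IsAuslanderRegular : Prop extends IsAuslanderGorenstein R where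
  gldim_left : FiniteLeftGlobalDimension R
  gldim_right : FiniteLeftGlobalDimension Rᵐᵒᵖ

variable (L : Type u) [AddCommGroup L] [Module R L]

/-- The grade `j_R(L)`, the least `j` with `Ext^j_R(L, R) ≠ 0` (and `⊤` if there is none). -/
noncomputable def moduleGrade : ℕ∞ :=
  ⨅ (j : ℕ) (_ : Nontrivial (ExtDual R L j)), (j : ℕ∞)

/-- `L` is `p`-Cohen-Macaulay: `Ext^i_R(L, R) = 0` for all `i ≠ p`. -/
def IsCMOfGrade (p : ℕ) : Prop :=
  ∀ i : ℕ, i ≠ p → Subsingleton (ExtDual R L i)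

end Rings

/-! ### Gelfand-Kirillov dimension and Cohen-Macaulay algebras -/

section GK

variable (k : Type v) [Field k] (R : Type u) [Ring R] [Algebra k R]

/-- The Gelfand-Kirillov dimension of a left module `L` over a `k`-algebra `R`: the supremum of
`limsup log (dim_k V^n F) / log n` over the finite-dimensional subspaces `1 ∈ V ⊆ R` and `F ⊆ L`.
The zero module has dimension `-∞`. -/
noncomputable def gkDim (L : Type u) [AddCommGroup L] [Module R L] [Module k L]
    [IsScalarTower k R L] : EReal :=
  ⨆ (V : Submodule k R) (_ : Module.Finite k V) (_ : (1 : R) ∈ V)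
    (F : Submodule k L) (_ : Module.Finite k F),
    Filter.limsup (fun n : ℕ =>
      ENNReal.log (Module.finrank k (V ^ n • F : Submodule k L) : ℕ) / ENNReal.log (n : ℕ))
      Filter.atTop

/-- `j_R(L) + GKdim(L) = GKdim(R)` for all nonzero finitely generated left `R`-modules `L`. The
`k`-structure of `L` is the one given by `k → R`. -/
def LeftCMCondition : Prop :=
  ∀ (L : Type u) [AddCommGroup L] [Module R L] [Module k L] [IsScalarTower k R L],
    Module.Finite R L → Nontrivial L →
      (((moduleGrade R L : ℕ∞) : ENNReal) : EReal) + gkDim k R L = gkDim k R R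

/-- Cohen-Macaulay algebras over a field, with the condition imposed on left and right modules. -/
structure IsCMAlgebra : Prop where
  gkDim_lt_top : gkDim k R R < ⊤
  cm_left : LeftCMCondition k R
  cm_right : LeftCMCondition k Rᵐᵒᵖ

end GK

/-!
Both conclusions are proved by induction on the projective dimension of `N`, through a short exact
sequence `0 → K → P → N → 0` with `P` finitely generated projective, so that `M ⊗_A P` is again
`m`-Cohen-Macaulay over `S`.

For (2), put `q = n + m`. The exact sequence `0 → Tor_1(M, N) → M ⊗ K → M ⊗ P → M ⊗ N → 0` and
dimension shifting carry to `K` the hypothesis that the higher `Tor` modules have `Ext_S(-, S)`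
concentrated in degree `q` while `Ext_S^i(M ⊗ -, S) = 0` for `i > q`; the degree `q` is kept fixed
although the projective dimension drops. By induction the higher `Tor` modules of `K` vanish, so
`Ext_S^q(M ⊗ K, S) = 0` for degree reasons. This forces `Ext_S^q(Tor_1(M, N), S) = 0`, and a
finitely generated module of finite projective dimension all of whose `Ext^i(-, S)` vanish is zero.

For (1), once the higher `Tor` modules vanish, `0 → M ⊗ K → M ⊗ P → M ⊗ N → 0` is exact, and both
sides of the claimed isomorphism are compared with those for `K` by connecting maps. The induction
starts from the natural map `Hom_A(P, A) ⊗_A Ext^m_S(M, S) → Ext^m_S(M ⊗_A P, S)`, which is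
bijective for `P` finitely generated projective because `P` has a dual basis.
-/

/-! ### Dimension shifting for left derived functors -/

section

open Limits

section

variable {C : Type*} [Category* C] [Abelian C]

theorem exact_epi_comp_iff {W X Y Z : C} (e : W ⟶ X) [Epi e] {f : X ⟶ Y} {g : Y ⟶ Z}
    (w : (e ≫ f) ≫ g = 0) (w' : f ≫ g = 0) :
    (ShortComplex.mk (e ≫ f) g w).Exact ↔ (ShortComplex.mk f g w').Exact := by
  let φ : ShortComplex.mk (e ≫ f) g w ⟶ ShortComplex.mk f g w' :=
    { τ₁ := e, τ₂ := 𝟙 _, τ₃ := 𝟙 _ }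
  have : Epi φ.τ₁ := ‹_›
  have : IsIso φ.τ₂ := inferInstanceAs (IsIso (𝟙 _))
  have : Mono φ.τ₃ := inferInstanceAs (Mono (𝟙 _))
  exact ShortComplex.exact_iff_of_epi_of_isIso_of_mono φ

theorem exact_comp_mono_iff {X Y Z W : C} {f : X ⟶ Y} {g : Y ⟶ Z} (i : Z ⟶ W) [Mono i]
    (w : f ≫ g ≫ i = 0) (w' : f ≫ g = 0) :
    (ShortComplex.mk f (g ≫ i) w).Exact ↔ (ShortComplex.mk f g w').Exact := by
  let φ : ShortComplex.mk f g w' ⟶ ShortComplex.mk f (g ≫ i) w :=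
    { τ₁ := 𝟙 _, τ₂ := 𝟙 _, τ₃ := i }
  have : Epi φ.τ₁ := inferInstanceAs (Epi (𝟙 _))
  have : IsIso φ.τ₂ := inferInstanceAs (IsIso (𝟙 _))
  have : Mono φ.τ₃ := ‹_›
  exact (ShortComplex.exact_iff_of_epi_of_isIso_of_mono φ).symm

theorem exactAt_succ_augment {K : ChainComplex C ℕ} {X : C} {f : K.X 0 ⟶ X}
    {w : K.d 1 0 ≫ f = 0} (hf : (ShortComplex.mk (K.d 1 0) f w).Exact)
    (hK : ∀ i, K.ExactAt (i + 1)) (i : ℕ) : (K.augment f w).ExactAt (i + 1) := by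
  rw [HomologicalComplex.exactAt_iff' _ (i + 2) (i + 1) i (by simp) (by simp)]
  obtain _ | i := i
  · exact hf
  · exact (K.exactAt_iff' (i + 2) (i + 1) i (by simp) (by simp)).1 (hK i)

theorem quasiIso_toSingle₀Equiv_symm {K : ChainComplex C ℕ} {X : C} {f : K.X 0 ⟶ X}
    {w : K.d 1 0 ≫ f = 0} (hf : (ShortComplex.mk (K.d 1 0) f w).Exact) (hepi : Epi f)
    (hK : ∀ i, K.ExactAt (i + 1)) : QuasiIso ((K.toSingle₀Equiv X).symm ⟨f, w⟩) := by
  refine ⟨fun i => ?_⟩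
  obtain _ | i := i
  · rw [ChainComplex.quasiIsoAt₀_iff, ShortComplex.quasiIso_iff_of_zeros' _
      (K.shape _ _ (by simp)) rfl rfl]
    refine (ShortComplex.exact_and_epi_g_iff_of_iso ?_).2 ⟨hf, hepi⟩
    refine ShortComplex.isoMk (Iso.refl _) (Iso.refl _) (Iso.refl _)
      ((Category.id_comp _).trans (Category.comp_id _).symm) ?_
    exact (Category.id_comp _).trans
      ((Category.comp_id _).trans (ChainComplex.toSingle₀Equiv_symm_apply_f_zero _ _)).symm
  · rw [quasiIsoAt_iff_exactAt' _ _ (ChainComplex.exactAt_succ_single_obj _ _)]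
    exact hK i

/-- The augmentation of a projective resolution, with target the resolved object itself rather than
the degree `0` term of a complex concentrated in degree `0`. -/
noncomputable def resolutionAugmentation {X : C} (Q : ProjectiveResolution X) :
    Q.complex.X 0 ⟶ X :=
  Q.π.f 0

instance {X : C} (Q : ProjectiveResolution X) : Epi (resolutionAugmentation Q) :=
  inferInstanceAs (Epi (Q.π.f 0))

@[simp]
theorem d_comp_resolutionAugmentation {X : C} (Q : ProjectiveResolution X) :
    Q.complex.d 1 0 ≫ resolutionAugmentation Q = 0 :=
  Q.complex_d_comp_π_f_zero

/-- The resolved object as the cokernel of the first differential of a projective resolution. -/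
noncomputable def isColimitResolutionAugmentation {X : C} (Q : ProjectiveResolution X) :
    IsColimit (CokernelCofork.ofπ _ (d_comp_resolutionAugmentation Q)) :=
  Q.isColimitCokernelCofork

theorem d_comp_resolutionAugmentation_comp {X Y : C} (Q : ProjectiveResolution X) (f : X ⟶ Y) :
    Q.complex.d 1 0 ≫ resolutionAugmentation Q ≫ f = 0 := by
  rw [← Category.assoc, d_comp_resolutionAugmentation, zero_comp]

/-- The projective resolution `⋯ → Q₁ → Q₀ → X₂` of `X₃` obtained from a projective resolution `Q`
of `X₁` and a short exact sequence `0 → X₁ → X₂ → X₃ → 0` with projective middle term. -/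
noncomputable def spliceResolution {T : ShortComplex C} (hT : T.ShortExact) [Projective T.X₂]
    (Q : ProjectiveResolution T.X₁) : ProjectiveResolution T.X₃ where
  complex := ChainComplex.augment Q.complex (resolutionAugmentation Q ≫ T.f)
    (d_comp_resolutionAugmentation_comp Q T.f)
  projective := by
    rintro (_ | i)
    · exact ‹Projective T.X₂›
    · exact Q.projective i
  π := (ChainComplex.toSingle₀Equiv _ _).symm
    ⟨T.g, show (resolutionAugmentation Q ≫ T.f) ≫ T.g = 0 by simp⟩
  quasiIso := by
    have := hT.mono_f
    refine quasiIso_toSingle₀Equiv_symm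
      ((exact_epi_comp_iff (resolutionAugmentation Q) (by simp) T.zero).2 hT.exact) hT.epi_g
      (exactAt_succ_augment ?_ Q.complex_exactAt_succ)
    exact (exact_comp_mono_iff T.f _ (d_comp_resolutionAugmentation Q)).2
      (ShortComplex.exact_of_g_is_cokernel _ (isColimitResolutionAugmentation Q))

/-- The homology of a short complex as the kernel of the map that its second morphism induces on a
cokernel `p` of its first one. -/
noncomputable def homologyIsoKernelOfIsCokernel (T : ShortComplex C) {Q : C} (p : T.X₂ ⟶ Q)
    (wp : T.f ≫ p = 0) (hp : IsColimit (CokernelCofork.ofπ p wp)) (h : Q ⟶ T.X₃)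
    (w : p ≫ h = T.g) : T.homology ≅ kernel h :=
  have hdesc : hp.desc (CokernelCofork.ofπ _ T.zero) = h :=
    Cofork.IsColimit.hom_ext hp ((hp.fac _ WalkingParallelPair.one).trans w.symm)
  letI data : T.RightHomologyData :=
    { Q := Q
      H := kernel h
      p := p
      ι := kernel.ι h
      wp := wp
      hp := hp
      wι := by rw [hdesc]; exact kernel.condition h
      hι := KernelFork.isLimitOfIsLimitOfIff' (kernelIsKernel h) _ fun _ φ => by rw [hdesc] }
  data.homologyIso

end

variable {C : Type*} [Category* C] [Abelian C] {D : Type*} [Category* D] [Abelian D]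
  (F : C ⥤ D) [F.Additive]

theorem exact_map_of_shortExact [PreservesFiniteColimits F] {T : ShortComplex C}
    (hT : T.ShortExact) : (T.map F).Exact ∧ Epi (F.map T.g) :=
  F.preservesFiniteColimits_iff_forall_exact_map_and_epi.1 ‹_› T hT

variable [EnoughProjectives C]

/-- Dimension shifting: `L_{j+2} F(X₃) ≅ L_{j+1} F(X₁)` for a short exact sequence with projective
middle term. -/
noncomputable def leftDerivedSuccSuccIso {T : ShortComplex C} (hT : T.ShortExact)
    [Projective T.X₂] (j : ℕ) :
    (F.leftDerived (j + 2)).obj T.X₃ ≅ (F.leftDerived (j + 1)).obj T.X₁ :=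
  letI Q := projectiveResolution T.X₁
  (spliceResolution hT Q).isoLeftDerivedObj F (j + 2) ≪≫
    HomologicalComplex.homologyIsoSc' _ (j + 3) (j + 2) (j + 1) (by simp) (by simp) ≪≫
    (HomologicalComplex.homologyIsoSc' ((F.mapHomologicalComplex _).obj Q.complex)
      (j + 2) (j + 1) j (by simp) (by simp)).symm ≪≫
    (Q.isoLeftDerivedObj F (j + 1)).symm

variable [PreservesFiniteColimits F]

/-- Dimension shifting in the lowest degree: `L_1 F(X₃)` is the kernel of `F(X₁) → F(X₂)`, for `F`
right exact and a short exact sequence with projective middle term. -/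
noncomputable def leftDerivedOneIsoKernel {T : ShortComplex C} (hT : T.ShortExact)
    [Projective T.X₂] : (F.leftDerived 1).obj T.X₃ ≅ kernel (F.map T.f) :=
  letI Q := projectiveResolution T.X₁
  letI ε := resolutionAugmentation Q
  have hε : F.map (Q.complex.d 1 0) ≫ F.map ε = 0 := by
    rw [← F.map_comp, d_comp_resolutionAugmentation, F.map_zero]
  have hεf : F.map (Q.complex.d 1 0) ≫ F.map (ε ≫ T.f) = 0 := by
    rw [← F.map_comp, d_comp_resolutionAugmentation_comp, F.map_zero]
  letI e : ((F.mapHomologicalComplex _).obj (spliceResolution hT Q).complex).sc' 2 1 0 ≅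
      ShortComplex.mk _ _ hεf :=
    ShortComplex.isoMk (Iso.refl _) (Iso.refl _) (Iso.refl _)
      ((Category.id_comp _).trans (Category.comp_id _).symm)
      ((Category.id_comp _).trans (Category.comp_id _).symm)
  (spliceResolution hT Q).isoLeftDerivedObj F 1 ≪≫
    HomologicalComplex.homologyIsoSc' _ 2 1 0 (by simp) (by simp) ≪≫
    ShortComplex.homologyMapIso e ≪≫
    homologyIsoKernelOfIsCokernel (ShortComplex.mk _ _ hεf) (F.map ε) hε
      (CokernelCofork.mapIsColimit _ (isColimitResolutionAugmentation Q) F) (F.map T.f)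
      (F.map_comp _ _).symm

/-- The exact sequence `0 → L₁F(X₃) → F(X₁) → F(X₂) → F(X₃) → 0`, cut at the image `I` of the middle
map. -/
theorem exists_shortExact_leftDerived_one {T : ShortComplex C} (hT : T.ShortExact)
    [Projective T.X₂] :
    ∃ (I : D) (a : (F.leftDerived 1).obj T.X₃ ⟶ F.obj T.X₁) (b : F.obj T.X₁ ⟶ I)
      (c : I ⟶ F.obj T.X₂) (w : a ≫ b = 0) (w' : c ≫ F.map T.g = 0),
      (ShortComplex.mk a b w).ShortExact ∧ (ShortComplex.mk c (F.map T.g) w').ShortExact := by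
  obtain ⟨hexact, hepi⟩ := exact_map_of_shortExact F hT
  let p := Abelian.factorThruImage (F.map T.f)
  let c := Abelian.image.ι (F.map T.f)
  have hpc : p ≫ c = F.map T.f := Abelian.image.fac _
  have hker : kernel.ι (F.map T.f) ≫ p = 0 := by
    rw [← cancel_mono c, Category.assoc, hpc, kernel.condition, zero_comp]
  have hc : c ≫ F.map T.g = 0 := by
    rw [← cancel_epi p, ← Category.assoc, hpc, ← F.map_comp, T.zero, F.map_zero, comp_zero]
  let e := leftDerivedOneIsoKernel F hT
  have hep : (e.hom ≫ kernel.ι (F.map T.f)) ≫ p = 0 := by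
    rw [Category.assoc, hker, comp_zero]
  have hexact₁ : (ShortComplex.mk _ _ hker).Exact := by
    refine (exact_comp_mono_iff c (by rw [hpc, kernel.condition]) hker).1 ?_
    simpa only [hpc] using ShortComplex.exact_kernel (F.map T.f)
  have hexact₂ : (ShortComplex.mk _ _ hc).Exact := by
    refine (exact_epi_comp_iff p (by rw [Category.assoc, hc, comp_zero]) hc).1 ?_
    simp only [hpc]
    exact hexact
  exact ⟨_, _, p, c, hep, hc,
    ShortComplex.ShortExact.mk' ((exact_epi_comp_iff e.hom hep hker).2 hexact₁)
      (mono_comp _ _) inferInstance,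
    ShortComplex.ShortExact.mk' hexact₂ inferInstance hepi⟩

theorem shortExact_map_of_isZero_leftDerived_one {T : ShortComplex C} (hT : T.ShortExact)
    [Projective T.X₂] (h : IsZero ((F.leftDerived 1).obj T.X₃)) : (T.map F).ShortExact :=
  ShortComplex.ShortExact.mk' (exact_map_of_shortExact F hT).1
    (Preadditive.mono_of_isZero_kernel _ (h.of_iso (leftDerivedOneIsoKernel F hT).symm))
    (exact_map_of_shortExact F hT).2

end

/-! ### Right exactness of the tensor product -/

theorem exact_of_comp_eq_mk {X Y Z : Type*} [AddCommGroup X] [AddCommGroup Y] [AddCommGroup Z]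
    {f : X →+ Y} {g : Y →+ Z} (hgf : g.comp f = 0) (s : Z →+ Y ⧸ f.range)
    (hs : s.comp g = QuotientAddGroup.mk' f.range) : Function.Exact f g := by
  refine fun y => ⟨fun hy => ?_, ?_⟩
  · have hmk : QuotientAddGroup.mk' f.range y = 0 := by
      rw [← hs, AddMonoidHom.comp_apply, hy, map_zero]
    exact (QuotientAddGroup.eq_zero_iff y).1 hmk
  · rintro ⟨x, rfl⟩
    exact DFunLike.congr_fun hgf x

namespace BalancedTensor

section Exactness

variable {A : Type*} [Ring A] {M : Type*} [AddCommGroup M] [Module Aᵐᵒᵖ M]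
  {N : Type*} [AddCommGroup N] [Module A N]

/-- The additive map on `M ⊗_A N` induced by a balanced biadditive map. -/
noncomputable def lift {G : Type*} [AddCommGroup G] (φ : M →+ N →+ G)
    (h : ∀ (x : M) (a : A) (y : N), φ (op a • x) y = φ x (a • y)) : BalancedTensor A M N →+ G :=
  QuotientAddGroup.lift (balancedRel A M N) (TensorProduct.liftAddHom φ (fun r x y => by simp))
    ((AddSubgroup.closure_le _).2 (by
      rintro _ ⟨x, a, y, rfl⟩
      simp [h]))

variable (A M N) in
/-- The universal biadditive map `(x, y) ↦ x ⊗ y`. -/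
noncomputable def tmulHom : M →+ N →+ BalancedTensor A M N :=
  AddMonoidHom.mk' (fun x => AddMonoidHom.mk' (tmul A x) (tmul_add x))
    fun x x' => AddMonoidHom.ext (add_tmul x x')

@[simp]
theorem tmulHom_apply (x : M) (y : N) : tmulHom A M N x y = tmul A x y := rfl

@[simp]
theorem tmul_zero (x : M) : tmul A x (0 : N) = 0 := _root_.map_zero (tmulHom A M N x)

@[simp]
theorem zero_tmul (y : N) : tmul A (0 : M) y = 0 := _root_.map_zero ((tmulHom A M N).flip y)

variable {M' : Type*} [AddCommGroup M'] [Module Aᵐᵒᵖ M']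
  {N' : Type*} [AddCommGroup N'] [Module A N']
  {M'' : Type*} [AddCommGroup M''] [Module Aᵐᵒᵖ M'']
  {N'' : Type*} [AddCommGroup N''] [Module A N'']

theorem map_surjective {f : M →ₗ[Aᵐᵒᵖ] M'} {g : N →ₗ[A] N'} (hf : Function.Surjective f)
    (hg : Function.Surjective g) : Function.Surjective (map f g) := fun z => by
  induction z using BalancedTensor.induction with
  | h0 => exact ⟨0, _root_.map_zero _⟩
  | ht x y =>
    obtain ⟨x, rfl⟩ := hf x
    obtain ⟨y, rfl⟩ := hg y
    exact ⟨tmul A x y, map_tmul f g x y⟩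
  | ha z w hz hw =>
    obtain ⟨z, rfl⟩ := hz
    obtain ⟨w, rfl⟩ := hw
    exact ⟨z + w, _root_.map_add _ _ _⟩

theorem exact_map_id_left {f : N →ₗ[A] N'} {g : N' →ₗ[A] N''} (hfg : Function.Exact f g)
    (hg : Function.Surjective g) :
    Function.Exact (map (LinearMap.id : M →ₗ[Aᵐᵒᵖ] M) f) (map LinearMap.id g) := by
  let π := QuotientAddGroup.mk' (map (LinearMap.id : M →ₗ[Aᵐᵒᵖ] M) f).range
  let Φ : N' →+ M →+ _ := (π.compHom.comp (tmulHom A M N')).flip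
  have hΦ : g.toAddMonoidHom.ker ≤ Φ.ker := fun y hy => by
    obtain ⟨w, rfl⟩ := (hfg y).1 hy
    exact AddMonoidHom.ext fun x => (QuotientAddGroup.eq_zero_iff _).2 ⟨tmul A x w, rfl⟩
  let Ψ := g.toAddMonoidHom.liftOfSurjective hg ⟨Φ, hΦ⟩
  have hΨ (y : N') : Ψ (g y) = Φ y :=
    AddMonoidHom.liftOfRightInverse_comp_apply g.toAddMonoidHom _ _ ⟨Φ, hΦ⟩ y
  have balanced (x : M) (a : A) (y : N'') : Ψ.flip (op a • x) y = Ψ.flip x (a • y) := by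
    obtain ⟨y, rfl⟩ := hg y
    rw [AddMonoidHom.flip_apply, AddMonoidHom.flip_apply, ← map_smul, hΨ, hΨ]
    exact congrArg π (op_smul_tmul x a y)
  have hcomp : (map LinearMap.id g).comp (map (LinearMap.id : M →ₗ[Aᵐᵒᵖ] M) f) = 0 :=
    hom_ext fun x y => by simp [hfg.apply_apply_eq_zero]
  have hlift : (lift Ψ.flip balanced).comp (map LinearMap.id g) = π :=
    hom_ext fun x y => DFunLike.congr_fun (hΨ y) x
  exact exact_of_comp_eq_mk hcomp _ hlift

theorem exact_map_id_right {f : M →ₗ[Aᵐᵒᵖ] M'} {g : M' →ₗ[Aᵐᵒᵖ] M''} (hfg : Function.Exact f g)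
    (hg : Function.Surjective g) :
    Function.Exact (map f (LinearMap.id : N →ₗ[A] N)) (map g LinearMap.id) := by
  let π := QuotientAddGroup.mk' (map f (LinearMap.id : N →ₗ[A] N)).range
  let Φ : M' →+ N →+ _ := π.compHom.comp (tmulHom A M' N)
  have hΦ : g.toAddMonoidHom.ker ≤ Φ.ker := fun x hx => by
    obtain ⟨w, rfl⟩ := (hfg x).1 hx
    exact AddMonoidHom.ext fun y => (QuotientAddGroup.eq_zero_iff _).2 ⟨tmul A w y, rfl⟩
  let Ψ := g.toAddMonoidHom.liftOfSurjective hg ⟨Φ, hΦ⟩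
  have hΨ (x : M') : Ψ (g x) = Φ x :=
    AddMonoidHom.liftOfRightInverse_comp_apply g.toAddMonoidHom _ _ ⟨Φ, hΦ⟩ x
  have balanced (x : M'') (a : A) (y : N) : Ψ (op a • x) y = Ψ x (a • y) := by
    obtain ⟨x, rfl⟩ := hg x
    rw [← map_smul, hΨ, hΨ]
    exact congrArg π (op_smul_tmul x a y)
  have hcomp : (map g LinearMap.id).comp (map f (LinearMap.id : N →ₗ[A] N)) = 0 :=
    hom_ext fun x y => by simp [hfg.apply_apply_eq_zero]
  have hlift : (lift Ψ balanced).comp (map g LinearMap.id) = π :=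
    hom_ext fun x y => DFunLike.congr_fun (hΨ x) y
  exact exact_of_comp_eq_mk hcomp _ hlift

end Exactness

section LeftModule

variable (T : Type*) [Ring T] {A : Type*} [Ring A] (M : Type*) [AddCommGroup M]
  [Module Aᵐᵒᵖ M] [Module T M] [SMulCommClass T Aᵐᵒᵖ M]

attribute [local instance] BalancedTensor.leftModule

/-- The map `x ↦ x ⊗ y`, linear for an action on the first factor. -/
noncomputable def tmulRight {N : Type*} [AddCommGroup N] [Module A N] (y : N) :
    M →ₗ[T] BalancedTensor A M N where
  toFun x := tmul A x y
  map_add' x x' := add_tmul x x' y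
  map_smul' _ _ := rfl

theorem finite_left (N : Type*) [AddCommGroup N] [Module A N] [Module.Finite T M]
    [Module.Finite A N] : Module.Finite T (BalancedTensor A M N) := by
  obtain ⟨r, t, ht⟩ := Module.Finite.exists_fin (R := A) (M := N)
  let φ : (Fin r → M) →ₗ[T] BalancedTensor A M N := ∑ i, tmulRight T M (t i) ∘ₗ LinearMap.proj i
  suffices hφ : Function.Surjective φ from Module.Finite.of_surjective φ hφ
  refine LinearMap.range_eq_top.1 (eq_top_iff.2 fun z _ => ?_)
  induction z using BalancedTensor.induction with
  | h0 => exact Submodule.zero_mem _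
  | ht x y =>
    obtain ⟨c, rfl⟩ := (Submodule.mem_span_range_iff_exists_fun A).1
      (show y ∈ Submodule.span A (Set.range t) from ht ▸ Submodule.mem_top)
    refine ⟨fun i => op (c i) • x, ?_⟩
    rw [← tmulHom_apply, map_sum, LinearMap.sum_apply]
    exact Finset.sum_congr rfl fun i _ => op_smul_tmul x (c i) (t i)
  | ha z w hz hw => exact Submodule.add_mem _ (hz trivial) (hw trivial)

/-- The isomorphism `M ⊗_A A ≅ M`, `x ⊗ a ↦ x • a`, linear for an action on `M`. -/
noncomputable def rid : BalancedTensor A M A ≃ₗ[T] M :=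
  letI f : BalancedTensor A M A →+ M :=
    lift (AddMonoidHom.mk' (fun x => AddMonoidHom.mk' (fun a => op a • x) fun a b => by
      rw [MulOpposite.op_add, add_smul]) fun x y => by ext; simp) fun x a b => by simp [mul_smul]
  { toFun := f
    map_add' := f.map_add
    map_smul' := fun t z => by
      induction z using BalancedTensor.induction with
      | h0 => simp
      | ht x a => exact (smul_comm t (op a : Aᵐᵒᵖ) x).symm
      | ha z w hz hw => rw [smul_add, f.map_add, hz, hw, f.map_add, smul_add]
    invFun := fun x => tmul A x 1
    left_inv := fun z => by
      induction z using BalancedTensor.induction with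
      | h0 => simp
      | ht x a =>
        change tmul A (op a • x) 1 = _
        rw [op_smul_tmul, smul_eq_mul, mul_one]
      | ha z w hz hw => simpa [add_tmul] using congrArg₂ (· + ·) hz hw
    right_inv := fun x => one_smul _ x }

end LeftModule

section RightModule

variable (T : Type*) [Ring T] {A : Type*} [Ring A] {M M' : Type*} [AddCommGroup M] [Module Aᵐᵒᵖ M]
  [AddCommGroup M'] [Module Aᵐᵒᵖ M'] (N : Type*) [AddCommGroup N] [Module A N] [Module T N]
  [SMulCommClass T A N]

attribute [local instance] BalancedTensor.rightModule

/-- The map `f ⊗ id`, linear for an action on the second factor. -/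
noncomputable def mapLeft (f : M →ₗ[Aᵐᵒᵖ] M') :
    BalancedTensor A M N →ₗ[T] BalancedTensor A M' N where
  toFun := map f LinearMap.id
  map_add' := _root_.map_add _
  map_smul' t z := by
    change map f LinearMap.id (map LinearMap.id (DistribSMul.toLinearMap A N t) z) =
      map LinearMap.id (DistribSMul.toLinearMap A N t) (map f LinearMap.id z)
    rw [map_comp_apply, map_comp_apply]
    rfl

/-- The isomorphism `f ⊗ id`, linear for an action on the second factor. -/
noncomputable def congrLeft (f : M ≃ₗ[Aᵐᵒᵖ] M') :
    BalancedTensor A M N ≃ₗ[T] BalancedTensor A M' N :=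
  { mapLeft T N f.toLinearMap with
    invFun := map f.symm.toLinearMap LinearMap.id
    left_inv := fun z => by
      change map _ _ (map _ _ z) = z
      rw [map_comp_apply, LinearMap.id_comp, LinearEquiv.symm_comp, map_id]
      rfl
    right_inv := fun z => by
      change map _ _ (map _ _ z) = z
      rw [map_comp_apply, LinearMap.id_comp, LinearEquiv.comp_symm, map_id]
      rfl }

end RightModule

end BalancedTensor

section

variable (S A : Type u) [Ring S] [Ring A] (M : Type u) [AddCommGroup M] [Module S M]
  [Module Aᵐᵒᵖ M] [SMulCommClass S Aᵐᵒᵖ M]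

instance : Limits.PreservesFiniteColimits (bimoduleTensor S A M) := by
  refine ((bimoduleTensor S A M).preservesFiniteColimits_tfae.out 0 3).1 fun T hT => ?_
  have hsurj := hT.moduleCat_surjective_g
  rw [ShortComplex.ShortExact.moduleCat_exact_iff_function_exact, ModuleCat.epi_iff_surjective]
  exact ⟨BalancedTensor.exact_map_id_left
      ((ShortComplex.ShortExact.moduleCat_exact_iff_function_exact T).1 hT.exact) hsurj,
    BalancedTensor.map_surjective Function.surjective_id hsurj⟩

instance [Module.Finite S M] (N : ModuleCat.{u} A) [Module.Finite A N] :
    Module.Finite S ((bimoduleTensor S A M).obj N) :=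
  BalancedTensor.finite_left S M N

/-- The isomorphism `M ⊗_A A ≅ M` of left `S`-modules. -/
noncomputable def bimoduleTensorUnit :
    (bimoduleTensor S A M).obj (ModuleCat.of A A) ≅ ModuleCat.of S M :=
  letI := BalancedTensor.leftModule S A M A
  (BalancedTensor.rid S M).toModuleIso

theorem bimoduleTensorUnit_naturality [SMulCommClass Aᵐᵒᵖ S M] (a : Aᵐᵒᵖ) :
    (bimoduleTensor S A M).map (ExtDual.smulHom A A a) ≫ (bimoduleTensorUnit S A M).hom =
      (bimoduleTensorUnit S A M).hom ≫ ExtDual.smulHom S M a := by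
  refine ModuleCat.hom_ext (LinearMap.ext fun z => ?_)
  induction z using BalancedTensor.induction with
  | h0 => exact (map_zero _).trans (map_zero _).symm
  | ht x b => exact mul_smul a (op b) x
  | ha z w hz hw => exact (map_add _ _ _).trans ((congrArg₂ _ hz hw).trans (map_add _ _ _).symm)

end

section

open Abelian

/-! ### The long exact sequence of `Ext(-, R)` -/

namespace ExtDual

variable {R : Type u} [Ring R]

/-- The right `R`-linear map on `Ext^j_R(-, R)` induced by a morphism. -/
noncomputable def precomp {X Y : ModuleCat.{u} R} (f : X ⟶ Y) (j : ℕ) :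
    ExtDual R Y j →ₗ[Rᵐᵒᵖ] ExtDual R X j where
  toFun x := (Ext.mk₀ f).comp (x : Ext.{u} Y (ModuleCat.of R R) j) (zero_add j)
  map_add' _ _ := Ext.comp_add _ _ _ _
  map_smul' r x := (Ext.comp_assoc_of_third_deg_zero (Ext.mk₀ f)
    (x : Ext.{u} Y (ModuleCat.of R R) j) (Ext.mk₀ (smulHom R R r)) (zero_add j)).symm

theorem precomp_id (X : ModuleCat.{u} R) (j : ℕ) (x : ExtDual R X j) : precomp (𝟙 X) j x = x :=
  Ext.mk₀_id_comp _

theorem precomp_comp {X Y Z : ModuleCat.{u} R} (f : X ⟶ Y) (g : Y ⟶ Z) (j : ℕ)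
    (x : ExtDual R Z j) : precomp (f ≫ g) j x = precomp f j (precomp g j x) :=
  (Ext.mk₀_comp_mk₀_assoc f g (x : Ext.{u} Z (ModuleCat.of R R) j)).symm

theorem precomp_add {X Y : ModuleCat.{u} R} (f g : X ⟶ Y) (j : ℕ) (x : ExtDual R Y j) :
    precomp (f + g) j x = precomp f j x + precomp g j x :=
  (congrArg (fun y : Ext.{u} X Y 0 => y.comp (x : Ext.{u} Y (ModuleCat.of R R) j) (zero_add j))
    (Ext.mk₀_add f g)).trans (Ext.add_comp _ _ _ _)

theorem precomp_sum {X Y : ModuleCat.{u} R} {ι : Type*} [Fintype ι] (f : ι → (X ⟶ Y)) (j : ℕ)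
    (x : ExtDual R Y j) : precomp (∑ i, f i) j x = ∑ i, precomp (f i) j x :=
  map_sum (AddMonoidHom.mk' (fun f : X ⟶ Y => precomp f j x) fun f g => precomp_add f g j x) f
    Finset.univ

theorem subsingleton_of_iso {X Y : ModuleCat.{u} R} (e : X ≅ Y) {i : ℕ}
    (h : Subsingleton (ExtDual R X i)) : Subsingleton (ExtDual R Y i) := by
  refine subsingleton_of_forall_eq 0 fun x => ?_
  rw [← precomp_id Y i x, ← e.inv_hom_id, precomp_comp, Subsingleton.elim (precomp e.hom i x) 0,
    map_zero]

theorem subsingleton_of_projective (P : ModuleCat.{u} R) [Projective P] {i : ℕ} (hi : 0 < i) :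
    Subsingleton (ExtDual R P i) := by
  obtain ⟨i, rfl⟩ := Nat.exists_eq_succ_of_ne_zero hi.ne'
  exact subsingleton_of_forall_eq 0 fun x =>
    Ext.eq_zero_of_projective (x : Ext.{u} P (ModuleCat.of R R) (i + 1))

variable {T : ShortComplex (ModuleCat.{u} R)} (hT : T.ShortExact)

/-- The connecting map `Ext^i_R(X₁, R) → Ext^j_R(X₃, R)`, `j = i + 1`, of a short exact sequence. -/
noncomputable def connecting {i j : ℕ} (h : 1 + i = j) :
    ExtDual R T.X₁ i →ₗ[Rᵐᵒᵖ] ExtDual R T.X₃ j where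
  toFun x := hT.extClass.comp (x : Ext.{u} T.X₁ (ModuleCat.of R R) i) h
  map_add' _ _ := Ext.comp_add _ _ _ _
  map_smul' r x := (Ext.comp_assoc_of_third_deg_zero hT.extClass
    (x : Ext.{u} T.X₁ (ModuleCat.of R R) i) (Ext.mk₀ (smulHom R R r)) h).symm

theorem exact_precomp_connecting {i j : ℕ} (h : 1 + i = j) :
    Function.Exact (precomp T.f i) (connecting hT h) := fun x => by
  constructor
  · intro hx
    exact Ext.contravariant_sequence_exact₁ hT _ x h hx
  · rintro ⟨y, rfl⟩
    exact hT.extClass_comp_assoc (y : Ext.{u} T.X₂ (ModuleCat.of R R) i) (h := h)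

theorem connecting_surjective {i j : ℕ} (h : 1 + i = j) (h₂ : Subsingleton (ExtDual R T.X₂ j)) :
    Function.Surjective (connecting hT h) := fun x =>
  Ext.contravariant_sequence_exact₃ hT _ x (h₂.elim _ _) h

theorem connecting_injective {i j : ℕ} (h : 1 + i = j) (h₂ : Subsingleton (ExtDual R T.X₂ i)) :
    Function.Injective (connecting hT h) := by
  rw [injective_iff_map_eq_zero]
  intro x hx
  obtain ⟨y, rfl⟩ := (exact_precomp_connecting hT h x).1 hx
  rw [h₂.elim y 0, map_zero]

/-- The connecting map as an isomorphism, when `Ext(X₂, R)` vanishes in both adjacent degrees. -/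
noncomputable def connectingEquiv {i j : ℕ} (h : 1 + i = j)
    (hi : Subsingleton (ExtDual R T.X₂ i)) (hj : Subsingleton (ExtDual R T.X₂ j)) :
    ExtDual R T.X₁ i ≃ₗ[Rᵐᵒᵖ] ExtDual R T.X₃ j :=
  LinearEquiv.ofBijective (connecting hT h)
    ⟨connecting_injective hT h hi, connecting_surjective hT h hj⟩

include hT

theorem subsingleton_X₁ {i : ℕ} (h₂ : Subsingleton (ExtDual R T.X₂ i))
    (h₃ : Subsingleton (ExtDual R T.X₃ (i + 1))) : Subsingleton (ExtDual R T.X₁ i) :=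
  ⟨fun _ _ => connecting_injective hT (add_comm 1 i) h₂ (h₃.elim _ _)⟩

theorem subsingleton_X₂ {i : ℕ} (h₁ : Subsingleton (ExtDual R T.X₁ i))
    (h₃ : Subsingleton (ExtDual R T.X₃ i)) : Subsingleton (ExtDual R T.X₂ i) := by
  refine subsingleton_of_forall_eq 0 fun x => ?_
  obtain ⟨y, rfl⟩ := Ext.contravariant_sequence_exact₂ hT (ModuleCat.of R R)
    (x : Ext.{u} T.X₂ (ModuleCat.of R R) i) (h₁.elim _ _)
  rw [h₃.elim y 0]
  exact Ext.comp_zero _ _ _ _ _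

theorem subsingleton_X₃ {i : ℕ} (h₁ : Subsingleton (ExtDual R T.X₁ i))
    (h₂ : Subsingleton (ExtDual R T.X₂ (i + 1))) : Subsingleton (ExtDual R T.X₃ (i + 1)) :=
  have := h₁
  (connecting_surjective hT (add_comm 1 i) h₂).subsingleton

end ExtDual

section FiniteModules

variable {R : Type u} [Ring R]

/-- The maps `f` are the coordinate functions of a dual basis, and each `p i` sends `1` to its
`i`-th element. -/
theorem exists_dualBasis_of_finite_projective (P : ModuleCat.{u} R) [Module.Finite R P]
    [Projective P] :
    ∃ (r : ℕ) (f : Fin r → (P ⟶ ModuleCat.of R R)) (p : Fin r → (ModuleCat.of R R ⟶ P)),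
      ∑ i, f i ≫ p i = 𝟙 P := by
  obtain ⟨r, g, f, -, -, h⟩ := Module.Finite.exists_comp_eq_id_of_projective R P
  refine ⟨r, fun i => ModuleCat.ofHom (LinearMap.proj i ∘ₗ f),
    fun i => ModuleCat.ofHom (g ∘ₗ LinearMap.single R (fun _ => R) i), ?_⟩
  ext x
  rw [ModuleCat.hom_sum, LinearMap.sum_apply]
  change ∑ i, g (Pi.single i (f x i)) = x
  rw [← map_sum, Finset.univ_sum_single]
  exact DFunLike.congr_fun h x

theorem exists_shortExact_finite_projective [IsNoetherianRing R] (X : ModuleCat.{u} R)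
    [Module.Finite R X] :
    ∃ T : ShortComplex (ModuleCat.{u} R), T.ShortExact ∧ T.X₃ = X ∧ Module.Finite R T.X₁ ∧
      Module.Finite R T.X₂ ∧ Projective T.X₂ := by
  obtain ⟨r, g, hg⟩ := Module.Finite.exists_fin' R X
  exact ⟨g.shortComplexKer, LinearMap.shortExact_shortComplexKer hg, rfl,
    inferInstanceAs (Module.Finite R (LinearMap.ker g)),
    inferInstanceAs (Module.Finite R (Fin r → R)),
    inferInstanceAs (Projective (ModuleCat.of R (Fin r → R)))⟩

theorem FiniteLeftGlobalDimension.projectiveDimension_ne_top (h : FiniteLeftGlobalDimension R)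
    (L : ModuleCat.{u} R) : projectiveDimension L ≠ ⊤ := by
  obtain ⟨d, hd⟩ := h
  exact (projectiveDimension_ne_top_iff L).2 ⟨d, (projectiveDimension_le_iff L d).1 (hd L)⟩

theorem ext_eq_zero_of_finite_projective {L : ModuleCat.{u} R} {i : ℕ}
    (h : Subsingleton (ExtDual R L i)) (P : ModuleCat.{u} R) [Module.Finite R P] [Projective P]
    (x : Ext.{u} L P i) : x = 0 := by
  obtain ⟨r, f, p, hfp⟩ := exists_dualBasis_of_finite_projective P
  rw [← Ext.comp_mk₀_id x, ← hfp, Ext.mk₀_sum, Ext.comp_sum]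
  refine Finset.sum_eq_zero fun k _ => ?_
  rw [← Ext.mk₀_comp_mk₀, ← Ext.comp_assoc_of_third_deg_zero,
    h.elim (x.comp (Ext.mk₀ (f k)) (add_zero i)) 0]
  exact Ext.zero_comp _ _ _ _ _

/-- Descending induction on `i`, from the degrees beyond the projective dimension of `L`. -/
theorem ext_eq_zero_of_subsingleton_extDual [IsNoetherianRing R] {L : ModuleCat.{u} R} (d : ℕ)
    [HasProjectiveDimensionLE L d] (h : ∀ i, Subsingleton (ExtDual R L i)) (X : ModuleCat.{u} R)
    [Module.Finite R X] {i : ℕ} (x : Ext.{u} L X i) : x = 0 := by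
  obtain ⟨c, hc⟩ : ∃ c, d < i + c := ⟨d + 1, by lia⟩
  induction c generalizing i X with
  | zero => exact x.eq_zero_of_hasProjectiveDimensionLT (d + 1) hc
  | succ c ih =>
    obtain ⟨T, hT, rfl, _, _, _⟩ := exists_shortExact_finite_projective X
    obtain ⟨y, rfl⟩ := Ext.covariant_sequence_exact₃ L hT x rfl (ih _ _ (by lia))
    rw [ext_eq_zero_of_finite_projective (h i) _ y, Ext.zero_comp]

theorem isZero_of_subsingleton_extDual [IsNoetherianRing R] (L : ModuleCat.{u} R)
    [Module.Finite R L] (hL : projectiveDimension L ≠ ⊤)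
    (h : ∀ i, Subsingleton (ExtDual R L i)) : Limits.IsZero L := by
  obtain ⟨d, _⟩ := (projectiveDimension_ne_top_iff L).1 hL
  rw [Limits.IsZero.iff_id_eq_zero, ← Ext.mk₀_eq_zero_iff]
  exact ext_eq_zero_of_subsingleton_extDual d h L _

end FiniteModules

/-! ### Vanishing of the higher `Tor` modules -/

section

variable {C : Type*} [Category* C] [Abelian C] [EnoughProjectives C] {S : Type u} [Ring S]
  (F : C ⥤ ModuleCat.{u} S) [F.Additive] [Limits.PreservesFiniteColimits F]
  {T : ShortComplex C} (hT : T.ShortExact) [Projective T.X₂] {i : ℕ}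

include hT

theorem subsingleton_extDual_obj_X₁
    (hTor : Subsingleton (ExtDual S ((F.leftDerived 1).obj T.X₃) i))
    (h₂ : Subsingleton (ExtDual S (F.obj T.X₂) i))
    (h₃ : Subsingleton (ExtDual S (F.obj T.X₃) (i + 1))) :
    Subsingleton (ExtDual S (F.obj T.X₁) i) := by
  obtain ⟨I, _, _, _, _, _, h₁I, hI₂⟩ := exists_shortExact_leftDerived_one F hT
  have hI : Subsingleton (ExtDual S I i) := ExtDual.subsingleton_X₁ hI₂ h₂ h₃
  exact ExtDual.subsingleton_X₂ h₁I hTor hI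

theorem subsingleton_extDual_leftDerived_one (h₁ : Subsingleton (ExtDual S (F.obj T.X₁) i))
    (h₂ : Subsingleton (ExtDual S (F.obj T.X₂) (i + 1)))
    (h₃ : Subsingleton (ExtDual S (F.obj T.X₃) (i + 2))) :
    Subsingleton (ExtDual S ((F.leftDerived 1).obj T.X₃) i) := by
  obtain ⟨I, _, _, _, _, _, h₁I, hI₂⟩ := exists_shortExact_leftDerived_one F hT
  have hI : Subsingleton (ExtDual S I (i + 1)) := ExtDual.subsingleton_X₁ hI₂ h₂ h₃
  exact ExtDual.subsingleton_X₁ h₁I h₁ hI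

theorem finite_leftDerived_one [IsNoetherianRing S] [Module.Finite S (F.obj T.X₁)] :
    Module.Finite S ((F.leftDerived 1).obj T.X₃) := by
  obtain ⟨_, a, _, _, _, _, h, _⟩ := exists_shortExact_leftDerived_one F hT
  exact Module.Finite.of_injective a.hom h.moduleCat_injective_f

end

section

variable {S A : Type u} [Ring S] [Ring A] {M : Type u} [AddCommGroup M] [Module S M]
  [Module Aᵐᵒᵖ M] [SMulCommClass S Aᵐᵒᵖ M] {m : ℕ}

theorem isCMOfGrade_bimoduleTensor (hM : IsCMOfGrade S M m) (P : ModuleCat.{u} A)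
    [Module.Finite A P] [Projective P] : IsCMOfGrade S ((bimoduleTensor S A M).obj P) m := by
  intro i hi
  have := ExtDual.subsingleton_of_iso (bimoduleTensorUnit S A M).symm (hM i hi)
  obtain ⟨r, f, p, hfp⟩ := exists_dualBasis_of_finite_projective P
  refine subsingleton_of_forall_eq 0 fun x => ?_
  rw [← ExtDual.precomp_id _ i x, ← (bimoduleTensor S A M).map_id, ← hfp, Functor.map_sum,
    ExtDual.precomp_sum]
  refine Finset.sum_eq_zero fun k _ => ?_
  rw [Functor.map_comp, ExtDual.precomp_comp,
    Subsingleton.elim (ExtDual.precomp ((bimoduleTensor S A M).map (p k)) i x) 0, map_zero]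

variable [IsNoetherianRing A]

theorem subsingleton_extDual_bimoduleTensor_of_lt (hM : IsCMOfGrade S M m) (d : ℕ)
    (N : ModuleCat.{u} A) [Module.Finite A N] [HasProjectiveDimensionLE N d]
    (hTor : ∀ j, Limits.IsZero (((bimoduleTensor S A M).leftDerived (j + 1)).obj N)) {i : ℕ}
    (hi : d + m < i) : Subsingleton (ExtDual S ((bimoduleTensor S A M).obj N) i) := by
  induction d generalizing N i with
  | zero =>
    have : Projective N := (projective_iff_hasProjectiveDimensionLE_zero N).2 ‹_›
    exact isCMOfGrade_bimoduleTensor hM N i (by lia)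
  | succ d ih =>
    obtain ⟨T, hT, rfl, _, _, _⟩ := exists_shortExact_finite_projective N
    have : HasProjectiveDimensionLE T.X₁ d := (hT.hasProjectiveDimensionLT_X₃_iff d ‹_›).1 ‹_›
    have hTor₁ (j) :=
      (hTor (j + 1)).of_iso (leftDerivedSuccSuccIso (bimoduleTensor S A M) hT j).symm
    obtain ⟨i, rfl⟩ := Nat.exists_eq_succ_of_ne_zero (by lia : i ≠ 0)
    exact ExtDual.subsingleton_X₃ (shortExact_map_of_isZero_leftDerived_one _ hT (hTor 0))
      (ih T.X₁ hTor₁ (by lia)) (isCMOfGrade_bimoduleTensor hM T.X₂ _ (by lia))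

theorem isZero_leftDerived_bimoduleTensor [IsNoetherianRing S]
    (hS : ∀ L : ModuleCat.{u} S, Module.Finite S L → projectiveDimension L ≠ ⊤)
    [Module.Finite S M] (hM : IsCMOfGrade S M m) {q : ℕ} (d : ℕ) (hd : d + m ≤ q)
    (N : ModuleCat.{u} A) [Module.Finite A N] [HasProjectiveDimensionLE N d]
    (hTor : ∀ j, IsCMOfGrade S (((bimoduleTensor S A M).leftDerived (j + 1)).obj N) q)
    (hN : ∀ i, q < i → Subsingleton (ExtDual S ((bimoduleTensor S A M).obj N) i)) (j : ℕ) :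
    Limits.IsZero (((bimoduleTensor S A M).leftDerived (j + 1)).obj N) := by
  induction d generalizing N j with
  | zero =>
    have : Projective N := (projective_iff_hasProjectiveDimensionLE_zero N).2 ‹_›
    exact Functor.isZero_leftDerived_obj_projective_succ _ j N
  | succ d ih =>
    obtain ⟨T, hT, rfl, _, _, _⟩ := exists_shortExact_finite_projective N
    have : HasProjectiveDimensionLE T.X₁ d := (hT.hasProjectiveDimensionLT_X₃_iff d ‹_›).1 ‹_›
    let F := bimoduleTensor S A M
    have hP : IsCMOfGrade S (F.obj T.X₂) m := isCMOfGrade_bimoduleTensor hM T.X₂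
    have hTor₁ (j) : Limits.IsZero ((F.leftDerived (j + 1)).obj T.X₁) :=
      ih (by lia) T.X₁
        (fun j i hi => ExtDual.subsingleton_of_iso (leftDerivedSuccSuccIso F hT j)
          (hTor (j + 1) i hi))
        (fun i hi => subsingleton_extDual_obj_X₁ F hT (hTor 0 i hi.ne') (hP i (by lia))
          (hN (i + 1) (by lia))) j
    obtain _ | j := j
    · have : Module.Finite S ((F.leftDerived 1).obj T.X₃) := finite_leftDerived_one F hT
      refine isZero_of_subsingleton_extDual _ (hS _ this) fun i => ?_
      obtain rfl | hi := eq_or_ne i q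
      · exact subsingleton_extDual_leftDerived_one F hT
          (subsingleton_extDual_bimoduleTensor_of_lt hM d T.X₁ hTor₁ (by lia)) (hP _ (by lia))
          (hN _ (by lia))
      · exact hTor 0 i hi
    · exact (hTor₁ j).of_iso (leftDerivedSuccSuccIso F hT j)

end

/-! ### Duality for finitely generated projective modules -/

namespace ExtDual

variable {R : Type u} [Ring R]

/-- `Ext^0_R(X, R)` is `Hom_R(X, R)`. -/
noncomputable def homEquiv (X : ModuleCat.{u} R) : ExtDual R X 0 ≃+ (X ⟶ ModuleCat.of R R) :=
  Ext.addEquiv₀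

theorem homEquiv_precomp {X Y : ModuleCat.{u} R} (g : X ⟶ Y) (x : ExtDual R Y 0) :
    homEquiv X (precomp g 0 x) = g ≫ homEquiv Y x := by
  obtain ⟨f, rfl⟩ := (homEquiv Y).symm.surjective x
  rw [AddEquiv.apply_symm_apply, ← AddEquiv.eq_symm_apply]
  exact Ext.mk₀_comp_mk₀ g f

theorem homEquiv_smul {X : ModuleCat.{u} R} (r : Rᵐᵒᵖ) (x : ExtDual R X 0) :
    homEquiv X (r • x) = homEquiv X x ≫ smulHom R R r := by
  obtain ⟨f, rfl⟩ := (homEquiv X).symm.surjective x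
  rw [AddEquiv.apply_symm_apply, ← AddEquiv.eq_symm_apply]
  exact Ext.mk₀_comp_mk₀ f (smulHom R R r)

end ExtDual

section HomTensorExt

variable (S : Type u) {A : Type u} [Ring S] [Ring A] (M : Type u) [AddCommGroup M] [Module S M]
  [Module Aᵐᵒᵖ M] [SMulCommClass S Aᵐᵒᵖ M] (m : ℕ)

attribute [local instance] BalancedTensor.rightModule

/-- The map `Ext^m_S(M, S) → Ext^m_S(M ⊗_A N, S)` induced by an `A`-linear map `N → A`. -/
noncomputable def extPullback {N : ModuleCat.{u} A} (h : N ⟶ ModuleCat.of A A) :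
    ExtDual S M m →ₗ[Sᵐᵒᵖ] ExtDual S ((bimoduleTensor S A M).obj N) m :=
  ExtDual.precomp ((bimoduleTensor S A M).map h ≫ (bimoduleTensorUnit S A M).hom) m

/-- The map `Ext^m_S(M ⊗_A N, S) → Ext^m_S(M, S)` induced by an `A`-linear map `A → N`. -/
noncomputable def extEvaluate {N : ModuleCat.{u} A} (p : ModuleCat.of A A ⟶ N) :
    ExtDual S ((bimoduleTensor S A M).obj N) m →ₗ[Sᵐᵒᵖ] ExtDual S M m :=
  ExtDual.precomp ((bimoduleTensorUnit S A M).inv ≫ (bimoduleTensor S A M).map p) m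

variable {S M m}

theorem extPullback_add {N : ModuleCat.{u} A} (h h' : N ⟶ ModuleCat.of A A) (e : ExtDual S M m) :
    extPullback S M m (h + h') e = extPullback S M m h e + extPullback S M m h' e := by
  have := ExtDual.precomp_add ((bimoduleTensor S A M).map h ≫ (bimoduleTensorUnit S A M).hom)
    ((bimoduleTensor S A M).map h' ≫ (bimoduleTensorUnit S A M).hom) m e
  rwa [← Preadditive.add_comp, ← Functor.map_add] at this

theorem precomp_extPullback {N N' : ModuleCat.{u} A} (g : N ⟶ N') (h : N' ⟶ ModuleCat.of A A)
    (e : ExtDual S M m) :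
    ExtDual.precomp ((bimoduleTensor S A M).map g) m (extPullback S M m h e) =
      extPullback S M m (g ≫ h) e := by
  have := ExtDual.precomp_comp ((bimoduleTensor S A M).map g)
    ((bimoduleTensor S A M).map h ≫ (bimoduleTensorUnit S A M).hom) m e
  rw [← Functor.map_comp_assoc] at this
  exact this.symm

theorem extPullback_comp_smulHom {N : ModuleCat.{u} A} (h : N ⟶ ModuleCat.of A A) (a : A)
    (e : ExtDual S M m) :
    extPullback S M m (h ≫ ExtDual.smulHom A A (op a)) e = extPullback S M m h (a • e) := by
  have : SMulCommClass Aᵐᵒᵖ S M := SMulCommClass.symm _ _ _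
  have := ExtDual.precomp_comp ((bimoduleTensor S A M).map h ≫ (bimoduleTensorUnit S A M).hom)
    (ExtDual.smulHom S M (op a)) m e
  rw [Category.assoc, ← bimoduleTensorUnit_naturality, ← Functor.map_comp_assoc] at this
  exact this

theorem extPullback_extEvaluate {N N' : ModuleCat.{u} A} (f : N' ⟶ ModuleCat.of A A)
    (p : ModuleCat.of A A ⟶ N) (x : ExtDual S ((bimoduleTensor S A M).obj N) m) :
    extPullback S M m f (extEvaluate S M m p x) =
      ExtDual.precomp ((bimoduleTensor S A M).map (f ≫ p)) m x := by
  have := ExtDual.precomp_comp ((bimoduleTensor S A M).map f ≫ (bimoduleTensorUnit S A M).hom)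
    ((bimoduleTensorUnit S A M).inv ≫ (bimoduleTensor S A M).map p) m x
  rw [Category.assoc, Iso.hom_inv_id_assoc, ← Functor.map_comp] at this
  exact this.symm

theorem extEvaluate_extPullback {N : ModuleCat.{u} A} (p : ModuleCat.of A A ⟶ N)
    (h : N ⟶ ModuleCat.of A A) {a : A} (ha : p ≫ h = ExtDual.smulHom A A (op a))
    (e : ExtDual S M m) : extEvaluate S M m p (extPullback S M m h e) = a • e := by
  have : SMulCommClass Aᵐᵒᵖ S M := SMulCommClass.symm _ _ _
  have := ExtDual.precomp_comp ((bimoduleTensorUnit S A M).inv ≫ (bimoduleTensor S A M).map p)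
    ((bimoduleTensor S A M).map h ≫ (bimoduleTensorUnit S A M).hom) m e
  rw [Category.assoc, ← Functor.map_comp_assoc, ha, bimoduleTensorUnit_naturality,
    Iso.inv_hom_id_assoc] at this
  exact this.symm

variable (S M m)

/-- The natural map `Hom_A(N, A) ⊗_A Ext^m_S(M, S) → Ext^m_S(M ⊗_A N, S)`. -/
noncomputable def homTensorExt (N : ModuleCat.{u} A) :
    BalancedTensor A (ExtDual A N 0) (ExtDual S M m) →ₗ[Sᵐᵒᵖ]
      ExtDual S ((bimoduleTensor S A M).obj N) m :=
  letI φ : ExtDual A N 0 →+ ExtDual S M m →+ ExtDual S ((bimoduleTensor S A M).obj N) m :=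
    AddMonoidHom.mk' (fun f => (extPullback S M m (ExtDual.homEquiv N f)).toAddMonoidHom)
      fun f g => AddMonoidHom.ext fun e => by
        simpa using extPullback_add (ExtDual.homEquiv N f) (ExtDual.homEquiv N g) e
  letI ψ := BalancedTensor.lift (A := A) φ fun f a e =>
    (congrArg (fun h => extPullback S M m h e) (ExtDual.homEquiv_smul (op a) f)).trans
      (extPullback_comp_smulHom _ a e)
  { toFun := ψ
    map_add' := ψ.map_add
    map_smul' := fun r z => by
      induction z using BalancedTensor.induction with
      | h0 => rw [smul_zero, ψ.map_zero, smul_zero]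
      | ht f e => exact (extPullback S M m (ExtDual.homEquiv N f)).map_smul r e
      | ha z w hz hw => rw [smul_add, ψ.map_add, hz, hw, ψ.map_add, smul_add] }

theorem homTensorExt_tmul (N : ModuleCat.{u} A) (f : ExtDual A N 0) (e : ExtDual S M m) :
    homTensorExt S M m N (BalancedTensor.tmul A f e) =
      extPullback S M m (ExtDual.homEquiv N f) e :=
  rfl

theorem homTensorExt_naturality {N N' : ModuleCat.{u} A} (g : N ⟶ N')
    (z : BalancedTensor A (ExtDual A N' 0) (ExtDual S M m)) :
    homTensorExt S M m N (BalancedTensor.mapLeft Sᵐᵒᵖ _ (ExtDual.precomp g 0) z) =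
      ExtDual.precomp ((bimoduleTensor S A M).map g) m (homTensorExt S M m N' z) := by
  induction z using BalancedTensor.induction with
  | h0 => simp only [map_zero]
  | ht f e =>
    change homTensorExt S M m N (BalancedTensor.tmul A (ExtDual.precomp g 0 f) e) = _
    rw [homTensorExt_tmul, homTensorExt_tmul, precomp_extPullback, ExtDual.homEquiv_precomp]
  | ha z w hz hw => simp only [map_add, hz, hw]

variable {S M m}

theorem tmul_extEvaluate_homTensorExt_tmul {N P : ModuleCat.{u} A} (f : N ⟶ ModuleCat.of A A)
    (p : ModuleCat.of A A ⟶ P) (h : ExtDual A P 0) (e : ExtDual S M m) :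
    BalancedTensor.tmul A ((ExtDual.homEquiv N).symm f)
        (extEvaluate S M m p (homTensorExt S M m P (BalancedTensor.tmul A h e))) =
      BalancedTensor.tmul A ((ExtDual.homEquiv N).symm ((f ≫ p) ≫ ExtDual.homEquiv P h)) e := by
  have hp : p ≫ ExtDual.homEquiv P h =
      ExtDual.smulHom A A (op ((ExtDual.homEquiv P h).hom (p.hom (1 : A)))) := by
    ext
    simp [ExtDual.smulHom]
  rw [homTensorExt_tmul, extEvaluate_extPullback p _ hp, ← BalancedTensor.op_smul_tmul,
    Category.assoc, hp]
  congr 1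
  rw [AddEquiv.eq_symm_apply, ExtDual.homEquiv_smul, AddEquiv.apply_symm_apply]

section DualBasis

variable {P : ModuleCat.{u} A} {r : ℕ} {f : Fin r → (P ⟶ ModuleCat.of A A)}
  {p : Fin r → (ModuleCat.of A A ⟶ P)} (hfp : ∑ i, f i ≫ p i = 𝟙 P)

include hfp

theorem sum_tmul_extEvaluate_homTensorExt
    (z : BalancedTensor A (ExtDual A P 0) (ExtDual S M m)) :
    ∑ i, BalancedTensor.tmul A ((ExtDual.homEquiv P).symm (f i))
      (extEvaluate S M m (p i) (homTensorExt S M m P z)) = z := by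
  induction z using BalancedTensor.induction with
  | h0 => simp only [map_zero, BalancedTensor.tmul_zero, Finset.sum_const_zero]
  | ht h e =>
    let τ := (BalancedTensor.tmulHom A (ExtDual A P 0) (ExtDual S M m)).flip e
    calc ∑ i, BalancedTensor.tmul A ((ExtDual.homEquiv P).symm (f i))
          (extEvaluate S M m (p i) (homTensorExt S M m P (BalancedTensor.tmul A h e)))
        = ∑ i, τ ((ExtDual.homEquiv P).symm ((f i ≫ p i) ≫ ExtDual.homEquiv P h)) :=
          Finset.sum_congr rfl fun i _ => tmul_extEvaluate_homTensorExt_tmul (f i) (p i) h e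
      _ = τ h := by
          rw [← map_sum, ← map_sum, ← Preadditive.sum_comp, hfp, Category.id_comp,
            AddEquiv.symm_apply_apply]
  | ha z w hz hw =>
    simp only [map_add, BalancedTensor.tmul_add, Finset.sum_add_distrib, hz, hw]

theorem homTensorExt_sum_tmul_extEvaluate (x : ExtDual S ((bimoduleTensor S A M).obj P) m) :
    homTensorExt S M m P (∑ i, BalancedTensor.tmul A ((ExtDual.homEquiv P).symm (f i))
      (extEvaluate S M m (p i) x)) = x := by
  simp only [map_sum, homTensorExt_tmul, AddEquiv.apply_symm_apply, extPullback_extEvaluate]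
  rw [← ExtDual.precomp_sum, ← Functor.map_sum, hfp, CategoryTheory.Functor.map_id,
    ExtDual.precomp_id]

end DualBasis

variable (S M m)

theorem homTensorExt_bijective (P : ModuleCat.{u} A) [Module.Finite A P] [Projective P] :
    Function.Bijective (homTensorExt S M m P) := by
  obtain ⟨r, f, p, hfp⟩ := exists_dualBasis_of_finite_projective P
  let inverse (x : ExtDual S ((bimoduleTensor S A M).obj P) m) :=
    ∑ i, BalancedTensor.tmul A ((ExtDual.homEquiv P).symm (f i)) (extEvaluate S M m (p i) x)
  exact Function.bijective_iff_has_inverse.2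
    ⟨inverse, sum_tmul_extEvaluate_homTensorExt hfp, homTensorExt_sum_tmul_extEvaluate hfp⟩

/-- For `P` finitely generated projective, the natural isomorphism
`Hom_A(P, A) ⊗_A Ext^m_S(M, S) ≅ Ext^m_S(M ⊗_A P, S)`. -/
noncomputable def homTensorExtEquiv (P : ModuleCat.{u} A) [Module.Finite A P] [Projective P] :
    BalancedTensor A (ExtDual A P 0) (ExtDual S M m) ≃ₗ[Sᵐᵒᵖ]
      ExtDual S ((bimoduleTensor S A M).obj P) m :=
  LinearEquiv.ofBijective (homTensorExt S M m P) (homTensorExt_bijective S M m P)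

end HomTensorExt

/-! ### The dual of the tensor product -/

theorem nonempty_linearEquiv_of_exact {R X Y Z X' Y' Z' : Type*} [Ring R]
    [AddCommGroup X] [Module R X] [AddCommGroup Y] [Module R Y] [AddCommGroup Z] [Module R Z]
    [AddCommGroup X'] [Module R X'] [AddCommGroup Y'] [Module R Y'] [AddCommGroup Z'] [Module R Z']
    {f : X →ₗ[R] Y} {g : Y →ₗ[R] Z} {f' : X' →ₗ[R] Y'} {g' : Y' →ₗ[R] Z'}
    (hfg : Function.Exact f g) (hg : Function.Surjective g)
    (hfg' : Function.Exact f' g') (hg' : Function.Surjective g')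
    {a : X →ₗ[R] X'} (ha : Function.Surjective a) (e : Y ≃ₗ[R] Y')
    (comm : ∀ x, e (f x) = f' (a x)) : Nonempty (Z ≃ₗ[R] Z') := by
  have hrange : f.range.map (e : Y →ₗ[R] Y') = f'.range := by
    rw [← LinearMap.range_comp, show (e : Y →ₗ[R] Y') ∘ₗ f = f' ∘ₗ a from LinearMap.ext comm,
      LinearMap.range_comp_of_range_eq_top _ (LinearMap.range_eq_top.2 ha)]
  exact ⟨(hfg.linearEquivOfSurjective hg).symm ≪≫ₗ Submodule.Quotient.equiv _ _ e hrange ≪≫ₗ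
    hfg'.linearEquivOfSurjective hg'⟩

section

variable {S A : Type u} [Ring S] [Ring A] {M : Type u} [AddCommGroup M] [Module S M]
  [Module Aᵐᵒᵖ M] [SMulCommClass S Aᵐᵒᵖ M] {m : ℕ}

attribute [local instance] BalancedTensor.rightModule

theorem nonempty_equiv_tensor_of_shortExact (hM : IsCMOfGrade S M m)
    {T : ShortComplex (ModuleCat.{u} A)} (hT : T.ShortExact)
    [Module.Finite A T.X₁] [Module.Finite A T.X₂] [Projective T.X₁] [Projective T.X₂]
    (hF : (T.map (bimoduleTensor S A M)).ShortExact) :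
    Nonempty (ExtDual S ((bimoduleTensor S A M).obj T.X₃) (1 + m) ≃ₗ[Sᵐᵒᵖ]
      BalancedTensor A (ExtDual A T.X₃ 1) (ExtDual S M m)) := by
  have hexact := ExtDual.exact_precomp_connecting hT (i := 0) (j := 1) rfl
  have hsurj := ExtDual.connecting_surjective hT (i := 0) (j := 1) rfl
    (ExtDual.subsingleton_of_projective T.X₂ one_pos)
  have hexactF := ExtDual.exact_precomp_connecting hF (i := m) (j := 1 + m) rfl
  have hsurjF := ExtDual.connecting_surjective hF (i := m) (j := 1 + m) rfl
    (isCMOfGrade_bimoduleTensor hM T.X₂ _ (by lia))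
  obtain ⟨e⟩ := nonempty_linearEquiv_of_exact
    (f := BalancedTensor.mapLeft Sᵐᵒᵖ (ExtDual S M m) (ExtDual.precomp T.f 0))
    (g := BalancedTensor.mapLeft Sᵐᵒᵖ (ExtDual S M m) (ExtDual.connecting hT rfl))
    (BalancedTensor.exact_map_id_right hexact hsurj)
    (BalancedTensor.map_surjective hsurj Function.surjective_id) hexactF hsurjF
    (homTensorExt_bijective S M m T.X₂).surjective (homTensorExtEquiv S M m T.X₁)
    (homTensorExt_naturality S M m T.f)
  exact ⟨e.symm⟩

theorem nonempty_equiv_tensor_of_isZero_leftDerived [IsNoetherianRing A]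
    (hM : IsCMOfGrade S M m) (d : ℕ) (N : ModuleCat.{u} A) [Module.Finite A N]
    [HasProjectiveDimensionLE N d]
    (hTor : ∀ j, Limits.IsZero (((bimoduleTensor S A M).leftDerived (j + 1)).obj N)) :
    Nonempty (ExtDual S ((bimoduleTensor S A M).obj N) (d + m) ≃ₗ[Sᵐᵒᵖ]
      BalancedTensor A (ExtDual A N d) (ExtDual S M m)) := by
  induction d generalizing N with
  | zero =>
    have : Projective N := (projective_iff_hasProjectiveDimensionLE_zero N).2 ‹_›
    rw [zero_add]
    exact ⟨(homTensorExtEquiv S M m N).symm⟩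
  | succ d ih =>
    obtain ⟨T, hT, rfl, _, _, _⟩ := exists_shortExact_finite_projective N
    have hpd : HasProjectiveDimensionLE T.X₁ d :=
      (hT.hasProjectiveDimensionLT_X₃_iff d ‹_›).1 ‹_›
    have hF := shortExact_map_of_isZero_leftDerived_one (bimoduleTensor S A M) hT (hTor 0)
    obtain rfl | hd := Nat.eq_zero_or_pos d
    · have : Projective T.X₁ := (projective_iff_hasProjectiveDimensionLE_zero _).2 hpd
      exact nonempty_equiv_tensor_of_shortExact hM hT hF
    · obtain ⟨e⟩ := ih T.X₁ fun j =>
        (hTor (j + 1)).of_iso (leftDerivedSuccSuccIso (bimoduleTensor S A M) hT j).symm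
      have hP : IsCMOfGrade S ((bimoduleTensor S A M).obj T.X₂) m :=
        isCMOfGrade_bimoduleTensor hM T.X₂
      let shift := ExtDual.connectingEquiv hT (add_comm 1 d)
        (ExtDual.subsingleton_of_projective T.X₂ hd)
        (ExtDual.subsingleton_of_projective T.X₂ d.succ_pos)
      let shiftF := ExtDual.connectingEquiv hF (i := d + m) (j := d + 1 + m) (by lia)
        (hP _ (by lia)) (hP _ (by lia))
      exact ⟨shiftF.symm ≪≫ₗ e ≪≫ₗ BalancedTensor.congrLeft Sᵐᵒᵖ (ExtDual S M m) shift⟩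

end

end

theorem mainTheorem10_general (S A : Type u) [Ring S] [IsNoetherianRing S] [Ring A]
    [IsNoetherianRing A]
    (hS : ∀ L : ModuleCat.{u} S, Module.Finite S L → projectiveDimension L ≠ ⊤) (n m : ℕ)
    (N : Type u) [AddCommGroup N] [Module A N] [Module.Finite A N]
    [HasProjectiveDimensionLE (ModuleCat.of A N) n]
    (M : Type u) [AddCommGroup M] [Module S M] [Module Aᵐᵒᵖ M] [SMulCommClass S Aᵐᵒᵖ M]
    [Module.Finite S M] (hM : IsCMOfGrade S M m)
    (hvan : ∀ i j : ℕ, i ≠ n + m → Subsingleton (ExtDual S (bimoduleTor S A M j N) i)) :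
    letI := BalancedTensor.leftModule S A M N
    letI := BalancedTensor.rightModule Sᵐᵒᵖ A (ExtDual A N n) (ExtDual S M m)
    Nonempty (ExtDual S (BalancedTensor A M N) (n + m) ≃ₗ[Sᵐᵒᵖ]
      BalancedTensor A (ExtDual A N n) (ExtDual S M m)) ∧
    ∀ i : ℕ, 0 < i → Subsingleton (bimoduleTor S A M i N) := by
  have hMN (i) (hi : n + m < i) :
      Subsingleton (ExtDual S ((bimoduleTensor S A M).obj (ModuleCat.of A N)) i) :=
    ExtDual.subsingleton_of_iso ((bimoduleTensor S A M).leftDerivedZeroIsoSelf.app _)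
      (hvan i 0 hi.ne')
  have hTor := isZero_leftDerived_bimoduleTensor hS hM n le_rfl (ModuleCat.of A N)
    (fun j i hi => hvan i (j + 1) hi) hMN
  refine ⟨nonempty_equiv_tensor_of_isZero_leftDerived hM n (ModuleCat.of A N) hTor,
    fun i hi => ?_⟩
  obtain ⟨j, rfl⟩ := Nat.exists_eq_succ_of_ne_zero hi.ne'
  exact ModuleCat.subsingleton_of_isZero (hTor j)

theorem mainTheorem10 (k : Type v) [Field k]
    (S A : Type u) [Ring S] [Algebra k S] [Ring A] [Algebra k A]
    (hS : IsAuslanderRegular S) (hS' : IsCMAlgebra k S)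
    (hA : IsAuslanderGorenstein A) (hA' : IsCMAlgebra k A)
    (n m : ℕ)
    (N : Type u) [AddCommGroup N] [Module A N] [Module.Finite A N]
    (hN : ∃ p : ℕ, IsCMOfGrade A N p)
    (hpd : projectiveDimension (ModuleCat.of A N) = (n : WithBot ℕ∞))
    (M : Type u) [AddCommGroup M] [Module S M] [Module Aᵐᵒᵖ M] [SMulCommClass S Aᵐᵒᵖ M]
    [Module.Finite S M]
    (hM : IsCMOfGrade S M m)
    (hvan : ∀ i j : ℕ, i ≠ n + m → Subsingleton (ExtDual S (bimoduleTor S A M j N) i)) :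
    -- `M ⊗_A N` is a left `S`-module through `M`, and `Ext^n_A(N, A) ⊗_A Ext^m_S(M, S)` is a right
    -- `S`-module through `Ext^m_S(M, S)`.
    letI := BalancedTensor.leftModule S A M N
    letI := BalancedTensor.rightModule Sᵐᵒᵖ A (ExtDual A N n) (ExtDual S M m)
    Nonempty (ExtDual S (BalancedTensor A M N) (n + m) ≃ₗ[Sᵐᵒᵖ]
      BalancedTensor A (ExtDual A N n) (ExtDual S M m)) ∧
    ∀ i : ℕ, 0 < i → Subsingleton (bimoduleTor S A M i N) := by
  have := hS.noetherian_left
  have := hA.noetherian_left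
  have := (projectiveDimension_le_iff (ModuleCat.of A N) n).1 hpd.le
  exact mainTheorem10_general S A (fun L _ => hS.gldim_left.projectiveDimension_ne_top L) n m N M
    hM hvan
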